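/- **Definitions.** A (finite relational) vocabulary $\tau$ is a finite set of relation symbols, each of a positive arity. Fix an order of the symbols. A $\tau$-structure $\mathcal A$ with universe $\{0,\dots,n-1\}$, $n\ge 0$, is encoded as the binary string that consists of $1^n0$ followed, for each symbol $R\in\tau$ of arity $r$, by the $n^r$ bits of the table of $R^{\mathcal A}$. For a set $S$ of elements, $\mathcal A\setminus S$ is the substructure induced on the elements outside $S$ (it may be empty). For a first-order $\tau$-sentence $\phi$ (with equality), the parameterized problem $\text{vd}_{\mathrm{arb}}(\phi)\subseteq\{0,1\}^*\times\mathbb N$ is the set of all pairs $(x,k)$ such that $x$ encodes a finite $\tau$-structure $\mathcal A$ for which there is a set $S$ of at most $k$ elements with $\mathcal A\setminus S\models\phi$. For a word $p\in\{e,a\}^*$, $\text{VD}_{\mathrm{arb}}(p)$ is the class of all problems $\text{vd}_{\mathrm{arb}}(\phi)$, over all vocabularies $\tau$, where $\phi$ is in prenex normal form and its quantifier prefix, read with $e$ for $\exists$ and $a$ for $\forall$, is $p$. The class $\text{para-AC}^0$ consists of the parameterized problems $Q\subseteq\{0,1\}^*\times\mathbb N$ for which there are a computable function $h\colon\mathbb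 N\to\mathbb N$, constants $c,d\in\mathbb N$ and a (not necessarily uniform) family $(C_{n,k})_{n,k\in\mathbb N}$ of Boolean circuits with NOT gates and AND and OR gates of unbounded fan-in, such that $C_{n,k}$ has $n$ inputs, one output, depth at most $d$ and at most $h(k)\cdot(n+1)^c$ gates, and such that for all $x\in\{0,1\}^*$ and $k\in\mathbb N$ we have $(x,k)\in Q$ if and only if $C_{|x|,k}$ outputs $1$ on $x$. **Lemma.** $\text{VD}_{\mathrm{arb}}(e^*a^*)\subseteq\text{para-AC}^0$. That is, for all $f,g\in\mathbb N$, every vocabulary $\tau$ and every $\tau$-sentence $\phi=\exists x_1\cdots\exists x_f\forall y_1\cdots\forall y_g\,\psi$ with $\psi$ quantifier-free, the problem $\text{vd}_{\mathrm{arb}}(\phi)$ is in $\text{para-AC}^0$. -/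

import Mathlib

namespace VertexDeletion

open FirstOrder

/-! ### Constant-depth circuits with unbounded fan-in -/

/-- A gate of a Boolean circuit with `n` inputs which may read the gates numbered `0, …, s - 1`.
The empty conjunction and the empty disjunction are the constants true and false. -/
inductive Gate (n s : ℕ) : Type
  | input (i : Fin n) : Gate n s
  | not (j : Fin s) : Gate n s
  | and (J : Finset (Fin s)) : Gate n s
  | or (J : Finset (Fin s)) : Gate n s

/-- A Boolean circuit with `n` inputs, one output and gates of unbounded fan-in: a directed acyclic
graph whose gates are listed in a topological order, so that gate `i` reads only gates `j < i`.
Its size is the number of gates (input gates included). -/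
structure Circuit (n : ℕ) : Type where
  size : ℕ
  gate : (i : Fin size) → Gate n i.val
  output : Fin size

namespace Circuit

variable {n : ℕ}

/-- The value of gate `i` on the input `x`. -/
def value (C : Circuit n) (x : Fin n → Bool) (i : Fin C.size) : Bool :=
  match C.gate i with
  | .input j => x j
  | .not j => !(C.value x ⟨j.val, j.isLt.trans i.isLt⟩)
  | .and J => decide (∀ j ∈ J, C.value x ⟨j.val, j.isLt.trans i.isLt⟩ = true)
  | .or J => decide (∃ j ∈ J, C.value x ⟨j.val, j.isLt.trans i.isLt⟩ = true)
termination_by i.val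
decreasing_by all_goals exact Fin.isLt _

/-- The depth of gate `i`: the largest number of non-input gates on a path that ends in `i`. -/
def gateDepth (C : Circuit n) (i : Fin C.size) : ℕ :=
  match C.gate i with
  | .input _ => 0
  | .not j => C.gateDepth ⟨j.val, j.isLt.trans i.isLt⟩ + 1
  | .and J => (J.sup fun j => C.gateDepth ⟨j.val, j.isLt.trans i.isLt⟩) + 1
  | .or J => (J.sup fun j => C.gateDepth ⟨j.val, j.isLt.trans i.isLt⟩) + 1
termination_by i.val
decreasing_by all_goals exact Fin.isLt _

/-- The output of the circuit on the input `x`. -/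
def eval (C : Circuit n) (x : Fin n → Bool) : Bool := C.value x C.output

/-- The depth of a circuit: the maximum of the depths of its gates. -/
def depth (C : Circuit n) : ℕ := Finset.univ.sup C.gateDepth

end Circuit

/-! ### Parameterized problems and para-AC⁰ -/

/-- A parameterized problem over the binary alphabet: a set of pairs (input, parameter). -/
abbrev ParameterizedProblem : Type := Set (List Bool × ℕ)

/-- The class para-AC⁰: problems decided by a family `C n k` of unbounded fan-in circuits, one for
each input length `n` and parameter `k`, of constant depth and of size `f k * n ^ O(1)` for a
computable `f`. (The polynomial is written in `n + 1` since a circuit has at least one gate, also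
when it has no inputs.) -/
def ParaAC0 : Set ParameterizedProblem :=
  {Q | ∃ (f : ℕ → ℕ) (c d : ℕ) (C : (n : ℕ) → ℕ → Circuit n),
    Computable f ∧
    (∀ n k, (C n k).size ≤ f k * (n + 1) ^ c) ∧
    (∀ n k, (C n k).depth ≤ d) ∧
    ∀ (x : List Bool) (k : ℕ), (x, k) ∈ Q ↔ (C x.length k).eval x.get = true}

/-! ### Finite relational structures and their encodings -/

/-- A finite relational vocabulary: finitely many relation symbols, numbered `0, …, card - 1`,
each of a positive arity. -/
structure Vocabulary : Type where
  card : ℕ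
  arity : Fin card → ℕ
  arity_pos : ∀ i, 0 < arity i

namespace Vocabulary

/-- The first-order language (with equality) of a vocabulary: the `r`-ary relation symbols are the
symbols of arity `r`, and there are no function symbols. -/
def language (τ : Vocabulary) : FirstOrder.Language.{0, 0} where
  Functions _ := Empty
  Relations r := {i : Fin τ.card // τ.arity i = r}

/-- The `i`-th relation symbol. -/
def symbol (τ : Vocabulary) (i : Fin τ.card) : τ.language.Relations (τ.arity i) := ⟨i, rfl⟩

/-- The table of the `i`-th relation of a structure on `{0, …, n - 1}`: one bit for each of the
`n ^ r` many `r`-tuples, where `r` is the arity of the symbol. -/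
noncomputable def table (τ : Vocabulary) {n : ℕ} (A : τ.language.Structure (Fin n))
    (i : Fin τ.card) : List Bool :=
  open scoped Classical in
  List.ofFn fun t : Fin (n ^ τ.arity i) =>
    decide (A.RelMap (τ.symbol i) (finFunctionFinEquiv.symm t))

/-- The binary encoding of a structure on `{0, …, n - 1}`: the number `n` in unary, written
`1 ⋯ 1 0`, followed by the tables of all relations. -/
noncomputable def encode (τ : Vocabulary) {n : ℕ} (A : τ.language.Structure (Fin n)) : List Bool :=
  List.replicate n true ++ false :: (List.finRange τ.card).flatMap (τ.table A)

/-- The substructure `A \ S` of `A` induced on the elements outside `S`. -/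
def delete (τ : Vocabulary) {M : Type} [τ.language.Structure M] (S : Set M) :
    τ.language.Substructure M where
  carrier := Sᶜ
  fun_mem f := Empty.elim f

end Vocabulary

/-! ### Vertex deletion problems and quantifier patterns -/

/-- The vertex deletion problem of the sentence `φ` on arbitrary finite structures: given (the
encoding of) a structure `A` and the parameter `k`, is there a set `S` of at most `k` elements of
`A` such that `A \ S` is a model of `φ`? Strings that encode no structure are no-instances. -/
def vertexDeletion (τ : Vocabulary) (φ : τ.language.Sentence) : ParameterizedProblem :=
  {q | ∃ (n : ℕ) (A : τ.language.Structure (Fin n)), q.1 = τ.encode A ∧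
    ∃ S : Finset (Fin n), S.card ≤ q.2 ∧ (τ.delete (S : Set (Fin n))) ⊨ φ}

/-- The letters of quantifier patterns: `e` for an existential, `a` for a universal quantifier. -/
inductive Quantifier : Type
  | e : Quantifier
  | a : Quantifier

/-- The formula is in prenex normal form, and its quantifier prefix has the given pattern. -/
inductive HasPattern {L : FirstOrder.Language.{0, 0}} :
    ∀ {m : ℕ}, L.BoundedFormula Empty m → List Quantifier → Prop
  | qf {m : ℕ} {φ : L.BoundedFormula Empty m} (h : φ.IsQF) : HasPattern φ []
  | ex {m : ℕ} {φ : L.BoundedFormula Empty (m + 1)} {p : List Quantifier}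
      (h : HasPattern φ p) : HasPattern φ.ex (Quantifier.e :: p)
  | all {m : ℕ} {φ : L.BoundedFormula Empty (m + 1)} {p : List Quantifier}
      (h : HasPattern φ p) : HasPattern φ.all (Quantifier.a :: p)

/-- The class of all vertex deletion problems on arbitrary finite structures, over all
vocabularies, that are defined by a sentence with the quantifier pattern `p`. -/
def vdArb (p : List Quantifier) : Set ParameterizedProblem :=
  {Q | ∃ (τ : Vocabulary) (φ : τ.language.Sentence), HasPattern φ p ∧ Q = vertexDeletion τ φ}

end VertexDeletion

namespace VertexDeletion

open FirstOrder

/-! Values `zs` of the existential variables are guessed by one wide disjunction. For fixed `zs`, a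
deletion set has to meet, for every tuple that extends `zs` and falsifies the matrix, the part of
the tuple outside `zs`. By `exists_deletion_iff` this is a hitting set problem for sets of bounded
size `d`.

Hitting set is solved by a constant number of sunflower-like rounds (`Forced`). If under some hash
function no `k` colours hit all differences `e' \ e` with forced `e' ⊃ e`, then every hitting set of
size at most `k` meets `e`. If no hash function shows this, there are no `k + 1` disjoint
differences, so few elements hit them all; branching over these elements at most `d` times gives a
bounded set `V` such that every member of the family contains a forced subset of `V`
(`exists_support`). When the empty set is not forced, a hash function that is injective on `V` turns
hitting colours back into elements (`exists_hitting_iff_not_forced`).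

A hash function reads `m ^ 2` bits of an element, where `m` depends on `k` and `d` only. There are
about `(log n) ^ (m ^ 2)` such functions, which is a function of `m` times `n + 1`
(`card_bitChoice_le`), so a single gate can range over them. Formulas of constant depth with such
fan-in unfold into the required circuits (`mem_paraAC0_of_hasFormula`). -/

/-! ### Formulas of bounded depth and fan-in, and their circuits -/

/-- The predicate on the inputs is computed by a formula (a tree-like circuit) of depth at most `d`
in which all gates have fan-in at most `M`. -/
inductive HasFormula (n M : ℕ) : ℕ → ((Fin n → Bool) → Prop) → Prop
  | lit (d : ℕ) (i : Fin n) : HasFormula n M d fun x => x i = true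
  | neg {d : ℕ} {P : (Fin n → Bool) → Prop} (h : HasFormula n M d P) :
      HasFormula n M (d + 1) fun x => ¬P x
  | all {d : ℕ} {ι : Type} [Finite ι] (hι : Nat.card ι ≤ M) {P : ι → (Fin n → Bool) → Prop}
      (h : ∀ i, HasFormula n M d (P i)) : HasFormula n M (d + 1) fun x => ∀ i, P i x
  | ex {d : ℕ} {ι : Type} [Finite ι] (hι : Nat.card ι ≤ M) {P : ι → (Fin n → Bool) → Prop}
      (h : ∀ i, HasFormula n M d (P i)) : HasFormula n M (d + 1) fun x => ∃ i, P i x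

/-- Gate number `i` computes the function `v i` and has depth `δ i`, provided that this holds of the
gates that it reads. -/
def Gate.Computes {n : ℕ} (v : ℕ → (Fin n → Bool) → Bool) (δ : ℕ → ℕ) {i : ℕ} :
    Gate n i → Prop
  | .input j => (∀ x, v i x = x j) ∧ δ i = 0
  | .not j => (∀ x, v i x = !v j x) ∧ δ i = δ j + 1
  | .and J => (∀ x, v i x = decide (∀ j ∈ J, v j x = true)) ∧ δ i = (J.sup fun j => δ j) + 1
  | .or J => (∀ x, v i x = decide (∃ j ∈ J, v j x = true)) ∧ δ i = (J.sup fun j => δ j) + 1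

theorem Gate.Computes.congr {n : ℕ} {v v' : ℕ → (Fin n → Bool) → Bool} {δ δ' : ℕ → ℕ} {i : ℕ}
    {g : Gate n i} (h : g.Computes v δ) (hv : ∀ j ≤ i, v' j = v j) (hδ : ∀ j ≤ i, δ' j = δ j) :
    g.Computes v' δ' := by
  have hv' : ∀ j : Fin i, v' j = v j := fun j => hv j j.isLt.le
  have hδ' : ∀ j : Fin i, δ' j = δ j := fun j => hδ j j.isLt.le
  cases g <;> simpa [Gate.Computes, hv i le_rfl, hδ i le_rfl, hv', hδ'] using h

/-- Values and depths are functions on all of `ℕ`. A gate reads only smaller indices, so appending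
it is an update at `s`, and no earlier gate is reindexed. -/
theorem Gate.exists_computes {n s : ℕ} (v : ℕ → (Fin n → Bool) → Bool) (δ : ℕ → ℕ)
    (g : Gate n s) : ∃ (v' : ℕ → (Fin n → Bool) → Bool) (δ' : ℕ → ℕ),
      (∀ j < s, v' j = v j) ∧ (∀ j < s, δ' j = δ j) ∧ g.Computes v' δ' := by
  have key : ∀ (a : (Fin n → Bool) → Bool) (b : ℕ),
      (∀ j < s, Function.update v s a j = v j) ∧ (∀ j < s, Function.update δ s b j = δ j) :=
    fun a b => ⟨fun j hj => Function.update_of_ne hj.ne _ _,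
      fun j hj => Function.update_of_ne hj.ne _ _⟩
  have hv : ∀ (a : (Fin n → Bool) → Bool) (j : Fin s), Function.update v s a j = v j :=
    fun a j => (key a 0).1 j j.isLt
  have hδ : ∀ (b : ℕ) (j : Fin s), Function.update δ s b j = δ j :=
    fun b j => (key (v 0) b).2 j j.isLt
  cases g with
  | input j =>
    exact ⟨_, _, (key (fun x => x j) 0).1, (key (fun x => x j) 0).2, by simp [Gate.Computes]⟩
  | not j =>
    exact ⟨_, _, (key (fun x => !v j x) (δ j + 1)).1, (key (fun x => !v j x) (δ j + 1)).2,
      by simp [Gate.Computes, hv, hδ]⟩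
  | and J =>
    let a : (Fin n → Bool) → Bool := fun x => decide (∀ j ∈ J, v j x = true)
    let b : ℕ := (J.sup fun j => δ j) + 1
    exact ⟨_, _, (key a b).1, (key a b).2, by simp [Gate.Computes, hv, hδ, a, b]⟩
  | or J =>
    let a : (Fin n → Bool) → Bool := fun x => decide (∃ j ∈ J, v j x = true)
    let b : ℕ := (J.sup fun j => δ j) + 1
    exact ⟨_, _, (key a b).1, (key a b).2, by simp [Gate.Computes, hv, hδ, a, b]⟩

/-- There are gates `0, …, s - 1`, in topological order, that compute the functions `v i`, have the
depths `δ i`, and these are at most `D`. -/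
def Realizable {n : ℕ} (D s : ℕ) (v : ℕ → (Fin n → Bool) → Bool) (δ : ℕ → ℕ) : Prop :=
  ∀ i < s, δ i ≤ D ∧ ∃ g : Gate n i, g.Computes v δ

theorem Realizable.extend {n D s : ℕ} {v : ℕ → (Fin n → Bool) → Bool} {δ : ℕ → ℕ}
    (h : Realizable D s v δ) (g : Gate n s) :
    ∃ (v' : ℕ → (Fin n → Bool) → Bool) (δ' : ℕ → ℕ),
      (∀ j < s, v' j = v j) ∧ (∀ j < s, δ' j = δ j) ∧ g.Computes v' δ' ∧
      (δ' s ≤ D → Realizable D (s + 1) v' δ') := by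
  obtain ⟨v', δ', hv, hδ, hg⟩ := g.exists_computes v δ
  refine ⟨v', δ', hv, hδ, hg, fun hD i hi => ?_⟩
  rcases Nat.lt_succ_iff_lt_or_eq.1 hi with hi | rfl
  · obtain ⟨h1, g', h2⟩ := h i hi
    exact ⟨(hδ i hi).le.trans h1, g', h2.congr (fun j hj => hv j (hj.trans_lt hi))
      fun j hj => hδ j (hj.trans_lt hi)⟩
  · exact ⟨hD, g, hg⟩

theorem Realizable.exists_circuit {n D s : ℕ} {v : ℕ → (Fin n → Bool) → Bool} {δ : ℕ → ℕ}
    (h : Realizable D s v δ) {o : ℕ} (ho : o < s) :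
    ∃ C : Circuit n, C.size = s ∧ C.depth ≤ D ∧ ∀ x, C.eval x = v o x := by
  choose hD g hg using h
  let C : Circuit n := ⟨s, fun i => g i i.isLt, ⟨o, ho⟩⟩
  have key : ∀ (i : ℕ) (hi : i < s), (∀ x, C.value x ⟨i, hi⟩ = v i x) ∧
      C.gateDepth ⟨i, hi⟩ = δ i := by
    intro i
    induction i using Nat.strong_induction_on with
    | _ i ih =>
      intro hi
      have hC : C.gate ⟨i, hi⟩ = g i hi := rfl
      have hgi := hg i hi
      have h1 : ∀ (j : Fin i) (hj : (j : ℕ) < s) (x : Fin n → Bool),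
          C.value x ⟨j, hj⟩ = v j x := fun j hj x => (ih j j.isLt hj).1 x
      have h2 : ∀ (j : Fin i) (hj : (j : ℕ) < s), C.gateDepth ⟨j, hj⟩ = δ j :=
        fun j hj => (ih j j.isLt hj).2
      generalize g i hi = g' at hC hgi
      constructor
      · intro x
        rw [Circuit.value, hC]
        cases g' with
        | input j => exact (hgi.1 x).symm
        | not j => simp only [hgi.1 x, h1]
        | and J => simp only [hgi.1 x, h1]
        | or J => simp only [hgi.1 x, h1]
      · rw [Circuit.gateDepth, hC]
        cases g' with
        | input j => exact hgi.2.symm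
        | not j => simp only [hgi.2, h2]
        | and J => simp only [hgi.2, h2]
        | or J => simp only [hgi.2, h2]
  refine ⟨C, rfl, Finset.sup_le fun i _ => ?_, fun x => (key o ho).1 x⟩
  exact (key i i.isLt).2.le.trans (hD i i.isLt)

/-- The formulas for `P` add at most `N` gates to any circuit, and the output has depth `d`. -/
def Extends {n : ℕ} (N d : ℕ) (P : (Fin n → Bool) → Prop) : Prop :=
  ∀ (D s : ℕ) (v : ℕ → (Fin n → Bool) → Bool) (δ : ℕ → ℕ), d ≤ D → Realizable D s v δ →
    ∃ (s' : ℕ) (v' : ℕ → (Fin n → Bool) → Bool) (δ' : ℕ → ℕ), s ≤ s' ∧ s' ≤ s + N ∧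
      (∀ j < s, v' j = v j) ∧ (∀ j < s, δ' j = δ j) ∧ Realizable D s' v' δ' ∧
      ∃ o < s', δ' o ≤ d ∧ ∀ x, v' o x = true ↔ P x

theorem Extends.family {n N d : ℕ} {ι : Type} {P : ι → (Fin n → Bool) → Prop}
    (h : ∀ i, Extends N d (P i)) (T : Finset ι) (D s : ℕ) (v : ℕ → (Fin n → Bool) → Bool)
    (δ : ℕ → ℕ) (hd : d ≤ D) (hr : Realizable D s v δ) :
    ∃ (s' : ℕ) (v' : ℕ → (Fin n → Bool) → Bool) (δ' : ℕ → ℕ), s ≤ s' ∧ s' ≤ s + T.card * N ∧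
      (∀ j < s, v' j = v j) ∧ (∀ j < s, δ' j = δ j) ∧ Realizable D s' v' δ' ∧
      ∀ i ∈ T, ∃ o < s', δ' o ≤ d ∧ ∀ x, v' o x = true ↔ P i x := by
  classical
  induction T using Finset.induction_on with
  | empty => exact ⟨s, v, δ, le_rfl, by simp, fun _ _ => rfl, fun _ _ => rfl, hr, by simp⟩
  | insert a T ha ih =>
    obtain ⟨s₁, v₁, δ₁, h1, h2, h3, h4, h5, h6⟩ := ih
    obtain ⟨s₂, v₂, δ₂, k1, k2, k3, k4, k5, k6⟩ := h a D s₁ v₁ δ₁ hd h5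
    refine ⟨s₂, v₂, δ₂, h1.trans k1, ?_, fun j hj => (k3 j (hj.trans_le h1)).trans (h3 j hj),
      fun j hj => (k4 j (hj.trans_le h1)).trans (h4 j hj), k5, ?_⟩
    · rw [Finset.card_insert_of_notMem ha, add_mul]
      omega
    · intro i hi
      rcases Finset.mem_insert.1 hi with rfl | hi
      · exact k6
      · obtain ⟨o, ho, hod, hox⟩ := h6 i hi
        exact ⟨o, ho.trans_le k1, by rw [k4 o ho]; exact hod, by rw [k3 o ho]; exact hox⟩

theorem Extends.gate_family {n N d M : ℕ} {ι : Type} [Finite ι] (hι : Nat.card ι ≤ M)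
    {P : ι → (Fin n → Bool) → Prop} (h : ∀ i, Extends N d (P i)) (conj : Bool) :
    Extends (M * N + 1) (d + 1)
      (fun x => if conj = true then ∀ i, P i x else ∃ i, P i x) := by
  classical
  intro D s v δ hd hr
  have := Fintype.ofFinite ι
  obtain ⟨s₁, v₁, δ₁, h1, h2, h3, h4, h5, h6⟩ :=
    Extends.family h Finset.univ D s v δ ((Nat.le_succ d).trans hd) hr
  choose! o ho hod hox using fun i => h6 i (Finset.mem_univ i)
  let J : Finset (Fin s₁) := Finset.univ.image fun i => ⟨o i, ho i⟩
  let g : Gate n s₁ := if conj = true then .and J else .or J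
  obtain ⟨v₂, δ₂, k3, k4, k5, k6⟩ := h5.extend g
  have hcard : Finset.univ.card (α := ι) * N ≤ M * N := by
    rw [Finset.card_univ, ← Nat.card_eq_fintype_card]
    exact Nat.mul_le_mul_right N hι
  have hsup : (J.sup fun j => δ₂ j) ≤ d := by
    refine Finset.sup_le fun j hj => ?_
    obtain ⟨i, -, rfl⟩ := Finset.mem_image.1 hj
    rw [k4 _ (ho i)]
    exact hod i
  have hdepth : δ₂ s₁ ≤ d + 1 := by
    cases conj <;> simp only [g, Gate.Computes, if_true, Bool.false_eq_true, if_false] at k5 <;>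
      rw [k5.2] <;> exact Nat.succ_le_succ hsup
  refine ⟨s₁ + 1, v₂, δ₂, by omega, by omega, fun j hj => (k3 j (by omega)).trans (h3 j hj),
    fun j hj => (k4 j (by omega)).trans (h4 j hj), k6 (hdepth.trans hd), s₁, by omega, hdepth,
    fun x => ?_⟩
  have hv : ∀ i, v₂ (o i) x = true ↔ P i x := fun i => by rw [k3 _ (ho i)]; exact hox i x
  cases conj <;> simp only [g, Gate.Computes, if_true, Bool.false_eq_true, if_false] at k5 <;>
    simp [k5.1 x, J, hv]

theorem HasFormula.extends {n M d : ℕ} (hM : 1 ≤ M) {P : (Fin n → Bool) → Prop}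
    (h : HasFormula n M d P) : Extends ((M + 1) ^ d) d P := by
  -- At most `M` subformulas and the top gate: this recursion yields the gate count `(M + 1) ^ d`.
  have hpow : ∀ d, M * (M + 1) ^ d + 1 ≤ (M + 1) ^ (d + 1) := fun d => by
    have := Nat.one_le_pow d (M + 1) (by omega)
    rw [pow_succ]
    nlinarith
  have mono : ∀ {N N' d : ℕ} {P : (Fin n → Bool) → Prop}, N ≤ N' → Extends N d P →
      Extends N' d P := by
    intro N N' d P hN h D s v δ hd hr
    obtain ⟨s', v', δ', h1, h2, h3⟩ := h D s v δ hd hr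
    exact ⟨s', v', δ', h1, by omega, h3⟩
  induction h with
  | lit d i =>
    intro D s v δ hd hr
    obtain ⟨v', δ', h1, h2, h3, h4⟩ := hr.extend (.input i)
    have := Nat.one_le_pow d (M + 1) (by omega)
    have h0 : δ' s = 0 := h3.2
    exact ⟨s + 1, v', δ', by omega, by omega, h1, h2, h4 (by omega), s, by omega, by omega,
      fun x => by rw [h3.1 x]⟩
  | neg _ ih =>
    rename_i d P _
    intro D s v δ hd hr
    obtain ⟨s₁, v₁, δ₁, h1, h2, h3, h4, h5, o, ho, hod, hox⟩ := ih D s v δ (by omega) hr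
    obtain ⟨v₂, δ₂, k3, k4, k5, k6⟩ := h5.extend (.not ⟨o, ho⟩)
    have hdepth : δ₂ s₁ ≤ d + 1 := by
      have : δ₂ s₁ = δ₂ o + 1 := k5.2
      rw [this, k4 o ho]
      omega
    have := hpow d
    have : (M + 1) ^ d ≤ M * (M + 1) ^ d := Nat.le_mul_of_pos_left _ hM
    refine ⟨s₁ + 1, v₂, δ₂, by omega, by omega, fun j hj => (k3 j (by omega)).trans (h3 j hj),
      fun j hj => (k4 j (by omega)).trans (h4 j hj), k6 (hdepth.trans hd), s₁, by omega, hdepth,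
      fun x => ?_⟩
    rw [k5.1 x]
    change _ ↔ ¬P x
    rw [← hox x]
    simp [k3 o ho]
  | all hι _ ih => simpa using mono (hpow _) (Extends.gate_family hι ih true)
  | ex hι _ ih => simpa using mono (hpow _) (Extends.gate_family hι ih false)

theorem HasFormula.exists_circuit {n M d : ℕ} (hM : 1 ≤ M) {P : (Fin n → Bool) → Prop}
    (h : HasFormula n M d P) :
    ∃ C : Circuit n, C.size ≤ (M + 1) ^ d ∧ C.depth ≤ d ∧ ∀ x, C.eval x = true ↔ P x := by
  obtain ⟨s, v, δ, -, h1, -, -, h2, o, ho, -, hox⟩ :=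
    h.extends hM d 0 (fun _ _ => true) (fun _ => 0) le_rfl fun i hi => absurd hi (Nat.not_lt_zero i)
  obtain ⟨C, hC, hd, hx⟩ := h2.exists_circuit ho
  exact ⟨C, by omega, hd, fun x => by rw [hx, hox]⟩

theorem HasFormula.mono {n M d d' : ℕ} {P : (Fin n → Bool) → Prop} (h : HasFormula n M d P)
    (hd : d ≤ d') : HasFormula n M d' P := by
  induction h generalizing d' with
  | lit d i => exact .lit d' i
  | neg _ ih =>
    obtain ⟨e, rfl⟩ := Nat.exists_eq_add_of_le' (Nat.one_le_of_lt hd)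
    exact .neg (ih (Nat.le_of_succ_le_succ hd))
  | all hι _ ih =>
    obtain ⟨e, rfl⟩ := Nat.exists_eq_add_of_le' (Nat.one_le_of_lt hd)
    exact .all hι fun i => ih i (Nat.le_of_succ_le_succ hd)
  | ex hι _ ih =>
    obtain ⟨e, rfl⟩ := Nat.exists_eq_add_of_le' (Nat.one_le_of_lt hd)
    exact .ex hι fun i => ih i (Nat.le_of_succ_le_succ hd)

/-- Empty conjunctions and disjunctions serve as constants; the family over `Empty` is arbitrary. -/
theorem HasFormula.const {n M d : ℕ} (p : Prop) : HasFormula n M (d + 1) fun _ => p := by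
  by_cases hp : p
  · have := HasFormula.all (n := n) (M := M) (d := d) (ι := Empty) (by simp)
      (P := fun _ _ => False) (fun i => i.elim)
    simpa [hp] using this
  · have := HasFormula.ex (n := n) (M := M) (d := d) (ι := Empty) (by simp)
      (P := fun _ _ => False) (fun i => i.elim)
    simpa [hp] using this

theorem HasFormula.or {n M d : ℕ} (hM : 2 ≤ M) {P Q : (Fin n → Bool) → Prop}
    (hP : HasFormula n M d P) (hQ : HasFormula n M d Q) :
    HasFormula n M (d + 1) fun x => P x ∨ Q x := by
  have := HasFormula.ex (ι := Bool) (by simpa using hM) (P := fun b => if b = true then P else Q)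
    (fun b => by cases b <;> simpa)
  simpa [or_comm] using this

theorem HasFormula.and {n M d : ℕ} (hM : 2 ≤ M) {P Q : (Fin n → Bool) → Prop}
    (hP : HasFormula n M d P) (hQ : HasFormula n M d Q) :
    HasFormula n M (d + 1) fun x => P x ∧ Q x := by
  have := HasFormula.all (ι := Bool) (by simpa using hM) (P := fun b => if b = true then P else Q)
    (fun b => by cases b <;> simpa)
  simpa [and_comm] using this

/-! ### From formulas to para-AC⁰ -/

theorem primrec_two_pow : Primrec fun k : ℕ => 2 ^ k := by
  refine (Primrec.nat_rec₁ (f := fun _ x => x + x) 1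
    (Primrec.nat_add.comp Primrec.snd Primrec.snd)).of_eq fun k => ?_
  induction k with
  | zero => rfl
  | succ k ih => rw [pow_succ, ← ih]; ring

theorem primrec_pow_const {h : ℕ → ℕ} (hh : Primrec h) (d : ℕ) : Primrec fun k => h k ^ d := by
  induction d with
  | zero => simpa using Primrec.const 1
  | succ d ih => simpa only [pow_succ] using Primrec.nat_mul.comp ih hh

/-- Formulas of constant depth whose fan-in is fixed-parameter polynomial witness membership in
para-AC⁰. -/
theorem mem_paraAC0_of_hasFormula {Q : ParameterizedProblem} {h : ℕ → ℕ} {c d : ℕ}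
    (hh : Primrec h) (hpos : ∀ k, 1 ≤ h k)
    (hQ : ∀ n k, HasFormula n (h k * (n + 1) ^ c) d fun w => (List.ofFn w, k) ∈ Q) :
    Q ∈ ParaAC0 := by
  have hM : ∀ n k, 1 ≤ h k * (n + 1) ^ c := fun n k =>
    Nat.mul_pos (hpos k) (pow_pos (Nat.succ_pos n) c)
  choose C hs hd hC using fun n k => (hQ n k).exists_circuit (hM n k)
  -- With `M = h k * (n + 1) ^ c ≥ 1`, the bound `(M + 1) ^ d ≤ (2 * M) ^ d` splits into a parameter
  -- factor and a power of `n + 1`.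
  refine ⟨fun k => (2 * h k) ^ d, c * d, d, C, ?_, fun n k => (hs n k).trans ?_, hd, fun x k => ?_⟩
  · exact (primrec_pow_const (Primrec.nat_mul.comp (Primrec.const 2) hh) d).to_comp
  · rw [pow_mul, ← mul_pow]
    have := hM n k
    exact Nat.pow_le_pow_left (by nlinarith) d
  · rw [hC, List.ofFn_get]

/-! ### Hash functions that read boundedly many bits -/

/-- The choice of `m ^ 2` bit positions below `Nat.size n + 1`. -/
abbrev BitChoice (n m : ℕ) : Type := Fin m × Fin m → Fin (Nat.size n + 1)

/-- The colours of the hash functions: bit vectors of length `m ^ 2`. -/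
abbrev Colour (m : ℕ) : Type := Fin m × Fin m → Bool

/-- The colour of `v` consists of the bits of `v` at the chosen positions. -/
def hash {n m : ℕ} (p : BitChoice n m) (v : Fin n) : Colour m := fun a => v.val.testBit (p a)

/-- Rank the elements of `V` by `Fin m` and choose, for each pair of ranks, a position at which the
two elements differ. -/
theorem exists_hash_injOn {n m : ℕ} (V : Finset (Fin n)) (hV : V.card ≤ m) :
    ∃ p : BitChoice n m, Set.InjOn (hash p) V := by
  let r : V → Fin m := fun v => Fin.castLE hV (V.equivFin v)
  have hr : Function.Injective r := fun u v h =>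
    V.equivFin.injective (Fin.castLE_injective hV h)
  have hbit : ∀ u v : Fin n, u ≠ v →
      ∃ i : Fin (Nat.size n + 1), u.val.testBit i ≠ v.val.testBit i := by
    intro u v huv
    by_contra! h
    refine huv (Fin.ext (Nat.eq_of_testBit_eq fun i => ?_))
    by_cases hi : i < Nat.size n + 1
    · exact h ⟨i, hi⟩
    · have hn : n < 2 ^ i := (Nat.lt_size_self n).trans_le
        (Nat.pow_le_pow_right two_pos (by omega))
      rw [Nat.testBit_eq_false_of_lt (u.isLt.trans hn),
        Nat.testBit_eq_false_of_lt (v.isLt.trans hn)]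
  have hp : ∀ a : Fin m × Fin m, ∃ i : Fin (Nat.size n + 1), ∀ u v : V,
      r u = a.1 → r v = a.2 → u ≠ v → u.val.val.testBit i ≠ v.val.val.testBit i := by
    rintro ⟨a, b⟩
    by_cases h : ∃ u v : V, r u = a ∧ r v = b ∧ u ≠ v
    · obtain ⟨u, v, rfl, rfl, huv⟩ := h
      obtain ⟨i, hi⟩ := hbit u v (fun h => huv (Subtype.ext h))
      refine ⟨i, fun u' v' hu hv _ => ?_⟩
      rw [hr hu, hr hv]
      exact hi
    -- A pair of ranks not attained by distinct elements imposes no condition. Position `0` exists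
    -- thanks to the `+ 1` in `BitChoice`.
    · exact ⟨0, fun u v hu hv huv => absurd ⟨u, v, hu, hv, huv⟩ h⟩
  choose p hp using hp
  refine ⟨p, fun u hu v hv huv => ?_⟩
  by_contra hne
  exact hp (r ⟨u, hu⟩, r ⟨v, hv⟩) ⟨u, hu⟩ ⟨v, hv⟩ rfl rfl (fun h => hne (congrArg Subtype.val h))
    (congrFun huv (r ⟨u, hu⟩, r ⟨v, hv⟩))

/-- With `s = Nat.size n` and `M = m ^ 2`, the power `(s + 1) ^ M` is at most `M!` times the
binomial coefficient of `s + M` over `M`, hence at most `M! * 2 ^ (s + M)`, and `2 ^ s` is linear in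
`n + 1`. -/
theorem card_bitChoice_le (n m : ℕ) :
    Nat.card (BitChoice n m) ≤ 2 ^ (m ^ 2 * m ^ 2 + m ^ 2 + 1) * (n + 1) := by
  have h1 : Nat.card (BitChoice n m) = (Nat.size n + 1) ^ (m ^ 2) := by
    simp [Nat.card_eq_fintype_card, sq]
  have h2 : 2 ^ Nat.size n ≤ 2 * (n + 1) := by
    rcases Nat.eq_zero_or_pos (Nat.size n) with h | h
    · rw [h, pow_zero]
      omega
    · obtain ⟨t, ht⟩ := Nat.exists_eq_add_of_le' h
      have : 2 ^ t ≤ n := Nat.lt_size.1 (by omega)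
      rw [ht, pow_succ]
      omega
  have h3 : ∀ M : ℕ, M.factorial ≤ 2 ^ (M * M) := fun M =>
    (Nat.factorial_le_pow M).trans (by
      rw [pow_mul]
      exact Nat.pow_le_pow_left Nat.lt_two_pow_self.le M)
  rw [h1]
  generalize m ^ 2 = M
  calc (Nat.size n + 1) ^ M ≤ (Nat.size n + 1).ascFactorial M := Nat.pow_succ_le_ascFactorial _ _
    _ = M.factorial * (Nat.size n + M).choose M := Nat.ascFactorial_eq_factorial_mul_choose _ _
    _ ≤ 2 ^ (M * M) * 2 ^ (Nat.size n + M) := Nat.mul_le_mul (h3 M) (Nat.choose_le_two_pow _ _)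
    _ = 2 ^ (M * M + M) * 2 ^ Nat.size n := by ring
    _ ≤ 2 ^ (M * M + M) * (2 * (n + 1)) := Nat.mul_le_mul_left _ h2
    _ = 2 ^ (M * M + M + 1) * (n + 1) := by ring

/-! ### Hitting sets in constant depth -/

/-- The sets which every hitting set of size at most `k` of the family `F` is recognized to hit
after `j` rounds: the members of `F`, and the sets `e` such that the differences `e' \ e` with
recognized supersets `e'` have no hitting set of size at most `k` among the colours of some hash
function. -/
def Forced {n : ℕ} (m k d : ℕ) (F : Finset (Fin n) → Prop) : ℕ → Finset (Fin n) → Prop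
  | 0, e => F e
  | j + 1, e => F e ∨ ∃ p : BitChoice n m, ∀ D : {D : Finset (Colour m) // D.card ≤ k},
      ∃ e' : {e' : Finset (Fin n) // e'.card ≤ d ∧ e ⊂ e' ∧
        Disjoint ((e' \ e).image (hash p)) D.val}, Forced m k d F j e'.val

section Forced

variable {n m k d : ℕ} {F : Finset (Fin n) → Prop}

theorem Forced.succ {j : ℕ} {e : Finset (Fin n)} (h : Forced m k d F j e) :
    Forced m k d F (j + 1) e := by
  induction j generalizing e with
  | zero => exact Or.inl h
  | succ j ih =>
    rcases h with h | ⟨p, h⟩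
    · exact Or.inl h
    · refine Or.inr ⟨p, fun D => ?_⟩
      obtain ⟨e', he'⟩ := h D
      exact ⟨e', ih he'⟩

theorem Forced.of_mem {e : Finset (Fin n)} (h : F e) (j : ℕ) : Forced m k d F j e := by
  cases j with
  | zero => exact h
  | succ j => exact Or.inl h

/-- If `S` missed `e`, it would meet each forced `e' ⊃ e` inside `e' \ e`. The at most `k` colours
of `S` would then hit all these differences. -/
theorem Forced.not_disjoint {S : Finset (Fin n)} (hS : S.card ≤ k)
    (hF : ∀ e, F e → ¬Disjoint e S) {j : ℕ} {e : Finset (Fin n)} (h : Forced m k d F j e) :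
    ¬Disjoint e S := by
  induction j generalizing e with
  | zero => exact hF e h
  | succ j ih =>
    rcases h with h | ⟨p, h⟩
    · exact hF e h
    · intro hdisj
      obtain ⟨⟨e', _, _, he'⟩, hj⟩ := h ⟨S.image (hash p), Finset.card_image_le.trans hS⟩
      obtain ⟨v, hv, hvS⟩ := Finset.not_disjoint_iff.1 (ih hj)
      have hve : v ∉ e := fun hve => Finset.disjoint_left.1 hdisj hve hvS
      exact Finset.disjoint_left.1 he'
        (Finset.mem_image_of_mem _ (Finset.mem_sdiff.2 ⟨hv, hve⟩)) (Finset.mem_image_of_mem _ hvS)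

/-- A family of nonempty sets of size at most `d` whose images under each hash function can be hit
by `k` colours can be hit by `k * d` elements. -/
theorem exists_hitting_of_colours (hm : (k + 1) * d ≤ m) {G : Finset (Fin n) → Prop}
    (hne : ∀ e, G e → e.Nonempty) (hcard : ∀ e, G e → e.card ≤ d)
    (hcol : ∀ p : BitChoice n m, ∃ D : Finset (Colour m), D.card ≤ k ∧
      ∀ e, G e → ¬Disjoint (e.image (hash p)) D) :
    ∃ P : Finset (Fin n), P.card ≤ k * d ∧ ∀ e, G e → ¬Disjoint e P := by
  classical
  let good : Finset (Finset (Fin n)) → Prop := fun T =>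
    (∀ e ∈ T, G e) ∧ (T : Set (Finset (Fin n))).PairwiseDisjoint id
  have hk : ∀ T, good T → T.card ≤ k := by
    rintro T ⟨hG, hT⟩
    -- Some hash function is injective on the union of `k + 1` disjoint members, as it has at most
    -- `(k + 1) * d` elements. Their hitting colours are then distinct, which is more than `k`
    -- colours.
    by_contra! hlt
    obtain ⟨Q, hQT, hQ⟩ := Finset.exists_subset_card_eq (Nat.succ_le_of_lt hlt)
    obtain ⟨p, hp⟩ := exists_hash_injOn (m := m) (Q.biUnion id)
      ((Finset.card_biUnion_le_card_mul Q id d fun e he => hcard e (hG e (hQT he))).trans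
        (by rw [hQ]; exact hm))
    obtain ⟨D, hD, hhit⟩ := hcol p
    have hex : ∀ e ∈ Q, ∃ v ∈ e, hash p v ∈ D := by
      intro e he
      obtain ⟨c, hc, hcD⟩ := Finset.not_disjoint_iff.1 (hhit e (hG e (hQT he)))
      obtain ⟨v, hv, rfl⟩ := Finset.mem_image.1 hc
      exact ⟨v, hv, hcD⟩
    have : Nonempty (Fin n) := by
      obtain ⟨e, he⟩ := Finset.card_pos.1 (by omega : 0 < Q.card)
      obtain ⟨v, -⟩ := hex e he
      exact ⟨v⟩
    choose! w hw hwD using hex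
    have hle : Q.card ≤ D.card := by
      refine Finset.card_le_card_of_injOn (fun e => hash p (w e)) (fun e he => hwD e he) ?_
      intro e he e' he' heq
      have hww : w e = w e' := hp (Finset.mem_coe.2 (Finset.mem_biUnion.2 ⟨e, he, hw e he⟩))
        (Finset.mem_coe.2 (Finset.mem_biUnion.2 ⟨e', he', hw e' he'⟩)) heq
      by_contra hee
      exact Finset.disjoint_left.1 (hT (hQT he) (hQT he') hee) (hw e he)
        (by rw [hww]; exact hw e' he')
    omega
  -- The union of a largest disjoint family meets every member, since a member missing it could be
  -- added.
  obtain ⟨T, hT, hmax⟩ := Finset.exists_max_image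
    (Finset.univ.filter good) Finset.card
    ⟨∅, Finset.mem_filter.2 ⟨Finset.mem_univ _, by simp [good]⟩⟩
  have hgood : good T := (Finset.mem_filter.1 hT).2
  refine ⟨T.biUnion id, (Finset.card_biUnion_le_card_mul T id d fun e he =>
    hcard e (hgood.1 e he)).trans (Nat.mul_le_mul_right d (hk T hgood)), fun e he hdisj => ?_⟩
  have hdT : ∀ e' ∈ T, Disjoint e e' := fun e' he' =>
    hdisj.mono_right (Finset.subset_biUnion_of_mem id he')
  have heT : e ∉ T := fun h => (hne e he).ne_empty (Finset.disjoint_self_iff_empty e |>.1 (hdT e h))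
  have hins : good (insert e T) := by
    refine ⟨fun e' he' => ?_, ?_⟩
    · rcases Finset.mem_insert.1 he' with rfl | h
      · exact he
      · exact hgood.1 e' h
    · rw [Finset.coe_insert]
      exact hgood.2.insert fun e' he' _ => hdT e' he'
  have := hmax _ (Finset.mem_filter.2 ⟨Finset.mem_univ _, hins⟩)
  rw [Finset.card_insert_of_notMem heT] at this
  omega

/-- A bound on the number of elements which occur in the minimal forced sets. -/
def supportBound (k d : ℕ) : ℕ → ℕ
  | 0 => 0
  | j + 1 => k * d * (1 + supportBound k d j)

/-- A bounded search tree, in which `j` bounds how many elements `c` still lacks to size `d`. A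
forced `c` is itself the set sought. Otherwise at most `k * d` elements `P` hit all differences, and
the search continues with `insert v c` for `v ∈ P`; this gives the recursion of `supportBound`. -/
theorem exists_support (hm : (k + 1) * d ≤ m) (hF : ∀ e, F e → e.card ≤ d) (j : ℕ)
    (c : Finset (Fin n)) (hc : d ≤ c.card + j) :
    ∃ V : Finset (Fin n), V.card ≤ supportBound k d j ∧ ∀ e, F e → c ⊆ e →
      ∃ e', Forced m k d F j e' ∧ e' ⊆ e ∧ e' ⊆ c ∪ V := by
  classical
  induction j generalizing c with
  | zero =>
    refine ⟨∅, by simp, fun e he hce => ⟨e, he, subset_rfl, ?_⟩⟩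
    rw [← Finset.eq_of_subset_of_card_le hce ((hF e he).trans hc)]
    exact Finset.subset_union_left
  | succ j ih =>
    by_cases hforced : Forced m k d F (j + 1) c
    · exact ⟨∅, by simp, fun e _ hce => ⟨c, hforced, hce, Finset.subset_union_left⟩⟩
    let G : Finset (Fin n) → Prop := fun a =>
      ∃ e', e'.card ≤ d ∧ c ⊂ e' ∧ Forced m k d F j e' ∧ e' \ c = a
    obtain ⟨P, hP, hhit⟩ := exists_hitting_of_colours (k := k) (d := d) hm (G := G)
      (by
        rintro _ ⟨e', -, hce, -, rfl⟩
        exact Finset.sdiff_nonempty.2 hce.2)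
      (by
        rintro _ ⟨e', hd, -, -, rfl⟩
        exact (Finset.card_le_card Finset.sdiff_subset).trans hd)
      (by
        intro p
        by_contra! hD
        refine hforced (Or.inr ⟨p, fun D => ?_⟩)
        obtain ⟨_, ⟨e', hd, hce, hj, rfl⟩, hdisj⟩ := hD D.1 D.2
        exact ⟨⟨e', hd, hce, hdisj⟩, hj⟩)
    -- For `v ∈ c` the set `insert v c` does not grow, so the induction does not apply; the empty
    -- set is a default there.
    have hV : ∀ v : Fin n, ∃ V : Finset (Fin n), V.card ≤ supportBound k d j ∧
        (v ∉ c → ∀ e, F e → insert v c ⊆ e →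
          ∃ e', Forced m k d F j e' ∧ e' ⊆ e ∧ e' ⊆ insert v c ∪ V) := by
      intro v
      by_cases hv : v ∈ c
      · exact ⟨∅, by simp, fun h => absurd hv h⟩
      · obtain ⟨V, h1, h2⟩ := ih (insert v c) (by
          rw [Finset.card_insert_of_notMem hv]; omega)
        exact ⟨V, h1, fun _ => h2⟩
    choose V hV1 hV2 using hV
    refine ⟨P ∪ P.biUnion V, ?_, fun e he hce => ?_⟩
    · calc (P ∪ P.biUnion V).card ≤ P.card + (P.biUnion V).card := Finset.card_union_le _ _
        _ ≤ P.card + P.card * supportBound k d j :=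
          Nat.add_le_add_left (Finset.card_biUnion_le_card_mul P V _ fun v _ => hV1 v) _
        _ = P.card * (1 + supportBound k d j) := by ring
        _ ≤ k * d * (1 + supportBound k d j) := Nat.mul_le_mul_right _ hP
    · have hne : c ≠ e := by
        rintro rfl
        exact hforced (Forced.of_mem he _)
      have hss : c ⊂ e := hce.ssubset_of_ne hne
      obtain ⟨v, hve, hvP⟩ := Finset.not_disjoint_iff.1
        (hhit _ ⟨e, hF e he, hss, Forced.of_mem he j, rfl⟩)
      obtain ⟨hve, hvc⟩ := Finset.mem_sdiff.1 hve
      obtain ⟨e', h1, h2, h3⟩ := hV2 v hvc e he (Finset.insert_subset hve hce)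
      refine ⟨e', h1.succ, h2, fun u hu => ?_⟩
      have hu' := h3 hu
      simp only [Finset.mem_union, Finset.mem_insert, Finset.mem_biUnion] at hu' ⊢
      rcases hu' with (rfl | h) | h
      · exact Or.inr (Or.inl hvP)
      · exact Or.inl h
      · exact Or.inr (Or.inr ⟨v, hvP, h⟩)

/-- A family of sets of size at most `d` has a hitting set of size at most `k` if and only if the
empty set is not forced. -/
theorem exists_hitting_iff_not_forced (hm : (k + 1) * d ≤ m) (hm' : supportBound k d d ≤ m)
    (hF : ∀ e, F e → e.card ≤ d) :
    (∃ S : Finset (Fin n), S.card ≤ k ∧ ∀ e, F e → ¬Disjoint e S) ↔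
      ¬Forced m k d F (d + 1) ∅ := by
  classical
  constructor
  · rintro ⟨S, hS, hhit⟩ h
    exact h.not_disjoint hS hhit (Finset.disjoint_empty_left S)
  · intro h
    -- The support uses `d` rounds; the last round is the test of the empty set itself.
    obtain ⟨V, hV, hVF⟩ := exists_support hm hF d ∅ (by omega)
    obtain ⟨p, hp⟩ := exists_hash_injOn V (hV.trans hm')
    obtain ⟨D, hD, hcol⟩ : ∃ D : Finset (Colour m), D.card ≤ k ∧ ∀ e : Finset (Fin n),
        e.card ≤ d → e.Nonempty → Forced m k d F d e → ¬Disjoint (e.image (hash p)) D := by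
      by_contra! hD
      refine h (Or.inr ⟨p, fun D => ?_⟩)
      obtain ⟨e, h1, h2, h3, h4⟩ := hD D.1 D.2
      exact ⟨⟨e, h1, Finset.empty_ssubset.2 h2, by simpa using h4⟩, h3⟩
    -- Injectivity on `V` bounds this set by `D.card ≤ k`. It hits every member because each
    -- contains a forced subset of `V`, and `D` hits the colours of that subset.
    refine ⟨V.filter fun v => hash p v ∈ D, ?_, fun e he => ?_⟩
    · refine (Finset.card_le_card_of_injOn (hash p) (fun v hv => ?_) ?_).trans hD
      · exact (Finset.mem_filter.1 hv).2
      · exact hp.mono (Finset.coe_subset.2 (Finset.filter_subset _ _))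
    · obtain ⟨e', h1, h2, h3⟩ := hVF e he (Finset.empty_subset e)
      have hne : e'.Nonempty := by
        rw [Finset.nonempty_iff_ne_empty]
        rintro rfl
        exact h h1.succ
      obtain ⟨c, hc, hcD⟩ := Finset.not_disjoint_iff.1
        (hcol e' ((Finset.card_le_card h2).trans (hF e he)) hne h1)
      obtain ⟨v, hv, rfl⟩ := Finset.mem_image.1 hc
      refine Finset.not_disjoint_iff.2 ⟨v, h2 hv, Finset.mem_filter.2 ⟨?_, hcD⟩⟩
      simpa using h3 hv

end Forced

/-! ### Forced sets as formulas of constant depth -/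

/-- Such a set is listed by a map from `Fin d`, padded with `none`. -/
theorem card_finset_card_le (n d : ℕ) (p : Finset (Fin n) → Prop) :
    Nat.card {e : Finset (Fin n) // e.card ≤ d ∧ p e} ≤ (n + 1) ^ d := by
  classical
  have hcard : Nat.card (Fin d → Option (Fin n)) = (n + 1) ^ d := by
    simp [Nat.card_eq_fintype_card]
  rw [← hcard]
  have hex : ∀ e : {e : Finset (Fin n) // e.card ≤ d ∧ p e},
      ∃ t : Fin d → Option (Fin n), ∀ v, v ∈ e.val ↔ ∃ i, t i = some v := by
    rintro ⟨e, he, -⟩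
    refine ⟨fun i => if h : i.val < e.card then some (e.equivFin.symm ⟨i, h⟩).val else none,
      fun v => ⟨fun hv => ?_, ?_⟩⟩
    · refine ⟨⟨e.equivFin ⟨v, hv⟩, (e.equivFin ⟨v, hv⟩).isLt.trans_le he⟩, ?_⟩
      simp
    · rintro ⟨i, hi⟩
      dsimp only at hi
      split_ifs at hi with h
      rw [← Option.some.inj hi]
      exact (e.equivFin.symm ⟨i, h⟩).2
  choose t ht using hex
  refine Nat.card_le_card_of_injective t fun e e' h => Subtype.ext (Finset.ext fun v => ?_)
  rw [ht, ht, h]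

/-- A round costs four levels: the binary disjunction, the hash function, the colour set and the
superset. Whether `e'` avoids the colours `D` depends on no input bit, so this test sits in the
index type and needs no gates. -/
theorem HasFormula.forced {N n M m k d : ℕ} (hM : 2 ≤ M)
    (h1 : Nat.card (BitChoice n m) ≤ M) (h2 : 2 ^ 2 ^ (m ^ 2) ≤ M) (h3 : (n + 1) ^ d ≤ M)
    {F : (Fin N → Bool) → Finset (Fin n) → Prop} {D : ℕ}
    (hF : ∀ e, HasFormula N M D fun x => F x e) (j : ℕ) (e : Finset (Fin n)) :
    HasFormula N M (D + 4 * j) fun x => Forced m k d (F x) j e := by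
  induction j generalizing e with
  | zero => exact hF e
  | succ j ih =>
    refine HasFormula.or hM (d := D + 4 * j + 3) ((hF e).mono (by omega)) ?_
    refine HasFormula.ex h1 fun p => HasFormula.all ?_ fun C => HasFormula.ex ?_ fun e' => ih e'
    · refine (Finite.card_subtype_le _).trans ?_
      simpa [Nat.card_eq_fintype_card, sq] using h2
    · exact (card_finset_card_le n d _).trans h3

/-! ### Prenex sentences with one quantifier alternation -/

/-- The block of quantifiers becomes one quantifier over extensions `ys` of `xs`. Leaving `N`
unspecified avoids casts between sums of indices. -/
theorem HasPattern.exists_all {L : FirstOrder.Language.{0, 0}} {g m : ℕ}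
    {φ : L.BoundedFormula Empty m} (h : HasPattern φ (List.replicate g Quantifier.a)) :
    ∃ (N : ℕ) (hN : m ≤ N) (ψ : L.BoundedFormula Empty N), ψ.IsQF ∧
      ∀ (M : Type) [L.Structure M] (xs : Fin m → M), φ.Realize default xs ↔
        ∀ ys : Fin N → M, ys ∘ Fin.castLE hN = xs → ψ.Realize default ys := by
  induction g generalizing m with
  | zero =>
    cases h with
    | qf h =>
      refine ⟨m, le_rfl, φ, h, fun M _ xs => ⟨?_, fun H => H xs rfl⟩⟩
      rintro H ys rfl
      exact H
  | succ g ih =>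
    cases h with
    | all h =>
      obtain ⟨N, hN, ψ, hψ, H⟩ := ih h
      refine ⟨N, Nat.le_of_succ_le hN, ψ, hψ, fun M _ xs => ?_⟩
      simp only [Language.BoundedFormula.realize_all, H]
      refine ⟨fun h' ys hys => h' (ys ⟨m, hN⟩) ys ?_, fun h' a ys hys => h' ys ?_⟩
      · subst hys
        funext i
        refine Fin.lastCases ?_ (fun i => ?_) i
        · simp only [Fin.snoc_last]
          rfl
        · simp only [Fin.snoc_castSucc]
          rfl
      · funext i
        have := congrFun hys i.castSucc
        rwa [Fin.snoc_castSucc] at this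

theorem HasPattern.exists_ex_all {L : FirstOrder.Language.{0, 0}} {f g m : ℕ}
    {φ : L.BoundedFormula Empty m}
    (h : HasPattern φ (List.replicate f Quantifier.e ++ List.replicate g Quantifier.a)) :
    ∃ (N₁ N₂ : ℕ) (h₁ : m ≤ N₁) (h₂ : N₁ ≤ N₂) (ψ : L.BoundedFormula Empty N₂), ψ.IsQF ∧
      ∀ (M : Type) [L.Structure M] (xs : Fin m → M), φ.Realize default xs ↔
        ∃ zs : Fin N₁ → M, zs ∘ Fin.castLE h₁ = xs ∧
          ∀ ys : Fin N₂ → M, ys ∘ Fin.castLE h₂ = zs → ψ.Realize default ys := by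
  induction f generalizing m with
  | zero =>
    obtain ⟨N, hN, ψ, hψ, H⟩ := HasPattern.exists_all (φ := φ) (g := g) (by simpa using h)
    refine ⟨m, N, le_rfl, hN, ψ, hψ, fun M _ xs => ?_⟩
    rw [H]
    refine ⟨fun h' => ⟨xs, rfl, h'⟩, ?_⟩
    rintro ⟨zs, rfl, h'⟩
    exact h'
  | succ f ih =>
    rw [List.replicate_succ, List.cons_append] at h
    cases h with
    | ex h =>
      obtain ⟨N₁, N₂, h₁, h₂, ψ, hψ, H⟩ := ih h
      refine ⟨N₁, N₂, Nat.le_of_succ_le h₁, h₂, ψ, hψ, fun M _ xs => ?_⟩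
      simp only [Language.BoundedFormula.realize_ex, H]
      constructor
      · rintro ⟨a, zs, hzs, h'⟩
        refine ⟨zs, ?_, h'⟩
        funext i
        have := congrFun hzs i.castSucc
        rwa [Fin.snoc_castSucc] at this
      · rintro ⟨zs, rfl, h'⟩
        refine ⟨zs ⟨m, h₁⟩, zs, ?_, h'⟩
        funext i
        refine Fin.lastCases ?_ (fun i => ?_) i
        · simp only [Fin.snoc_last]
          rfl
        · simp only [Fin.snoc_castSucc]
          rfl

/-! ### Reduction of vertex deletion to hitting set -/

/-- The sets of elements that falsify the universal part of a sentence, for given values `zs` of the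
existential variables. -/
def Conflict (τ : Vocabulary) {n N₁ N₂ : ℕ} (A : τ.language.Structure (Fin n)) (h : N₁ ≤ N₂)
    (ψ : τ.language.BoundedFormula Empty N₂) (zs : Fin N₁ → Fin n) (e : Finset (Fin n)) : Prop :=
  ∃ ys : {ys : Fin N₂ → Fin n // ys ∘ Fin.castLE h = zs ∧
    Finset.univ.image ys \ Finset.univ.image zs = e}, ¬ψ.Realize default ys.val

theorem Conflict.card_le {τ : Vocabulary} {n N₁ N₂ : ℕ} {A : τ.language.Structure (Fin n)}
    {h : N₁ ≤ N₂} {ψ : τ.language.BoundedFormula Empty N₂} {zs : Fin N₁ → Fin n}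
    {e : Finset (Fin n)} (he : Conflict τ A h ψ zs e) : e.card ≤ N₂ := by
  obtain ⟨⟨ys, -, rfl⟩, -⟩ := he
  exact (Finset.card_le_card Finset.sdiff_subset).trans (Finset.card_image_le.trans (by simp))

/-- The values of `zs` must survive the deletion. No conflict contains them, so they can be removed
from any hitting set. -/
theorem exists_deletion_iff (τ : Vocabulary) {n N₁ N₂ : ℕ} (A : τ.language.Structure (Fin n))
    {h₁ : 0 ≤ N₁} {h₂ : N₁ ≤ N₂} {φ : τ.language.Sentence}
    {ψ : τ.language.BoundedFormula Empty N₂} (hψ : ψ.IsQF)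
    (hφ : ∀ (M : Type) [τ.language.Structure M] (xs : Fin 0 → M),
      Language.BoundedFormula.Realize φ default xs ↔
        ∃ zs : Fin N₁ → M, zs ∘ Fin.castLE h₁ = xs ∧
          ∀ ys : Fin N₂ → M, ys ∘ Fin.castLE h₂ = zs → ψ.Realize default ys) (k : ℕ) :
    (∃ S : Finset (Fin n), S.card ≤ k ∧ (τ.delete (S : Set (Fin n))) ⊨ φ) ↔
      ∃ zs : Fin N₁ → Fin n, ∃ S : Finset (Fin n), S.card ≤ k ∧
        ∀ e, Conflict τ A h₂ ψ zs e → ¬Disjoint e S := by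
  have hmodel : ∀ S : Finset (Fin n), ((τ.delete (S : Set (Fin n))) ⊨ φ) ↔
      ∃ zs : Fin N₁ → Fin n, (∀ i, zs i ∉ S) ∧ ∀ ys : Fin N₂ → Fin n, (∀ i, ys i ∉ S) →
        ys ∘ Fin.castLE h₂ = zs → ψ.Realize default ys := by
    intro S
    -- The truth of a quantifier-free formula is preserved by the inclusion, so quantifiers over the
    -- substructure become quantifiers over elements outside `S`.
    let ι := (τ.delete (S : Set (Fin n))).subtype
    have hι : ∀ ys : Fin N₂ → τ.delete (S : Set (Fin n)),
        ψ.Realize default (ι ∘ ys) ↔ ψ.Realize default ys := fun ys => by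
      rw [← hψ.realize_embedding ι, Subsingleton.elim (ι ∘ default) default]
    refine (hφ _ default).trans ⟨?_, ?_⟩
    · rintro ⟨zs, -, H⟩
      refine ⟨ι ∘ zs, fun i => (zs i).2, fun ys hys hext => ?_⟩
      refine (hι fun i => ⟨ys i, hys i⟩).2 (H _ ?_)
      funext i
      exact Subtype.ext (congrFun hext i)
    · rintro ⟨zs, hzs, H⟩
      refine ⟨fun i => ⟨zs i, hzs i⟩, Subsingleton.elim _ _, fun ys hext => ?_⟩
      refine (hι ys).1 (H _ (fun i => (ys i).2) ?_)
      funext i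
      exact congrArg Subtype.val (congrFun hext i)
  constructor
  · rintro ⟨S, hS, H⟩
    obtain ⟨zs, hzs, H⟩ := (hmodel S).1 H
    refine ⟨zs, S, hS, ?_⟩
    rintro _ ⟨⟨ys, hext, rfl⟩, hys⟩ hdisj
    refine hys (H ys (fun i hi => ?_) hext)
    refine Finset.disjoint_left.1 hdisj (Finset.mem_sdiff.2 ⟨by simp, fun hz => ?_⟩) hi
    obtain ⟨j, -, hj⟩ := Finset.mem_image.1 hz
    exact hzs j (by rw [hj]; exact hi)
  · rintro ⟨zs, S, hS, H⟩
    refine ⟨S \ Finset.univ.image zs, (Finset.card_le_card Finset.sdiff_subset).trans hS,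
      (hmodel _).2 ⟨zs, fun i => by simp, fun ys hys hext => ?_⟩⟩
    by_contra hfalse
    obtain ⟨v, hv, hvS⟩ := Finset.not_disjoint_iff.1 (H _ ⟨⟨ys, hext, rfl⟩, hfalse⟩)
    obtain ⟨hvy, hvz⟩ := Finset.mem_sdiff.1 hv
    obtain ⟨i, -, rfl⟩ := Finset.mem_image.1 hvy
    exact hys i (Finset.mem_sdiff.2 ⟨hvS, hvz⟩)

/-! ### Quantifier-free formulas as circuits -/

/-- The depth depends on `ψ` only. For fixed `ys` a relational atom is an input bit and an equality
is a constant. -/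
theorem exists_hasFormula_of_isQF (τ : Vocabulary) {N : ℕ}
    {ψ : τ.language.BoundedFormula Empty N} (hψ : ψ.IsQF) :
    ∃ D : ℕ, ∀ (n l M : ℕ) (_ : 2 ≤ M) (A : (Fin l → Bool) → τ.language.Structure (Fin n))
      (_ : ∀ (r : ℕ) (R : τ.language.Relations r) (ts : Fin r → Fin n),
        ∃ p : Fin l, ∀ w, (A w).RelMap R ts ↔ w p = true) (ys : Fin N → Fin n),
      HasFormula l M D fun w => letI := A w; ψ.Realize default ys := by
  have hterm : ∀ t : τ.language.Term (Empty ⊕ Fin N), ∃ i, t = .var (Sum.inr i) := by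
    intro t
    cases t with
    | var a =>
      rcases a with a | i
      · exact a.elim
      · exact ⟨i, rfl⟩
    | func f _ => exact Empty.elim f
  induction hψ with
  | falsum => exact ⟨1, fun n l M _ A _ ys => HasFormula.const False⟩
  | of_isAtomic h =>
    cases h with
    | equal t₁ t₂ =>
      refine ⟨1, fun n l M _ A _ ys => ?_⟩
      obtain ⟨i, rfl⟩ := hterm t₁
      obtain ⟨j, rfl⟩ := hterm t₂
      simpa [Language.BoundedFormula.realize_bdEqual] using HasFormula.const (ys i = ys j)
    | rel R ts =>
      refine ⟨0, fun n l M _ A hA ys => ?_⟩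
      choose i hi using fun a => hterm (ts a)
      obtain ⟨p, hp⟩ := hA _ R fun a => ys (i a)
      simpa [Language.BoundedFormula.realize_rel, hi, hp] using HasFormula.lit 0 p
  | imp _ _ ih₁ ih₂ =>
    obtain ⟨D₁, H₁⟩ := ih₁
    obtain ⟨D₂, H₂⟩ := ih₂
    refine ⟨max D₁ D₂ + 2, fun n l M hM A hA ys => ?_⟩
    have := HasFormula.or hM (d := max D₁ D₂ + 1)
      ((H₁ n l M hM A hA ys).neg.mono (Nat.succ_le_succ (le_max_left _ _)))
      ((H₂ n l M hM A hA ys).mono (Nat.le_succ_of_le (le_max_right _ _)))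
    simpa only [Language.BoundedFormula.realize_imp, imp_iff_not_or] using this

/-! ### Decoding -/

/-- The position is chosen before `f`, as it depends on block lengths only. Hence an atom is read
from the same bit in the codes of all structures with `n` elements. -/
theorem exists_getElem_flatMap {α : Type} (len : α → ℕ) (l : List α) {a : α} (ha : a ∈ l) {t : ℕ}
    (ht : t < len a) : ∃ p < (l.map len).sum, ∀ f : α → List Bool,
      (∀ a, (f a).length = len a) → (l.flatMap f)[p]? = (f a)[t]? := by
  induction l with
  | nil => simp at ha
  | cons b l ih =>
    by_cases hab : a = b
    · subst hab
      refine ⟨t, by simp; omega, fun f hf => ?_⟩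
      rw [List.flatMap_cons, List.getElem?_append_left (by rw [hf]; exact ht)]
    · obtain ⟨p, hp, H⟩ := ih (List.mem_of_ne_of_mem hab ha)
      refine ⟨len b + p, by simp; omega, fun f hf => ?_⟩
      rw [List.flatMap_cons, List.getElem?_append_right (by rw [hf]; omega), hf,
        Nat.add_sub_cancel_left, H f hf]

theorem exists_flatMap_eq {α : Type} [DecidableEq α] (len : α → ℕ) (l : List α) (hl : l.Nodup)
    (y : List Bool) (hy : y.length = (l.map len).sum) :
    ∃ f : α → List Bool, (∀ a, (f a).length = len a) ∧ l.flatMap f = y := by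
  induction l generalizing y with
  | nil =>
    refine ⟨fun a => List.replicate (len a) true, by simp, ?_⟩
    simpa [eq_comm] using hy
  | cons b l ih =>
    rw [List.map_cons, List.sum_cons] at hy
    obtain ⟨f, hf, H⟩ := ih hl.of_cons (y.drop (len b)) (by rw [List.length_drop]; omega)
    refine ⟨Function.update f b (y.take (len b)), fun a => ?_, ?_⟩
    · by_cases hab : a = b
      · subst hab
        rw [Function.update_self, List.length_take]
        omega
      · rw [Function.update_of_ne hab, hf]
    · have hb : b ∉ l := (List.nodup_cons.1 hl).1
      have : l.flatMap (Function.update f b (y.take (len b))) = l.flatMap f :=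
        List.flatMap_congr fun a ha => Function.update_of_ne (fun h => hb (by rwa [← h])) _ _
      rw [List.flatMap_cons, Function.update_self, this, H, List.take_append_drop]

namespace Vocabulary

variable (τ : Vocabulary)

/-- The length of the codes of the structures with `n` elements. -/
def codeLength (n : ℕ) : ℕ :=
  n + 1 + ((List.finRange τ.card).map fun i => n ^ τ.arity i).sum

theorem lt_codeLength (n : ℕ) : n < τ.codeLength n := by
  unfold codeLength
  omega

theorem length_table {n : ℕ} (A : τ.language.Structure (Fin n)) (i : Fin τ.card) :
    (τ.table A i).length = n ^ τ.arity i := by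
  simp [table]

theorem length_encode {n : ℕ} (A : τ.language.Structure (Fin n)) :
    (τ.encode A).length = τ.codeLength n := by
  simp [encode, codeLength, List.length_flatMap, length_table]
  omega

/-- The length of a code determines `n`, so each circuit deals with a single universe size. -/
theorem codeLength_strictMono : StrictMono τ.codeLength := by
  intro n n' h
  have : ((List.finRange τ.card).map fun i => n ^ τ.arity i).sum ≤
      ((List.finRange τ.card).map fun i => n' ^ τ.arity i).sum :=
    List.sum_le_sum fun i _ => Nat.pow_le_pow_left h.le _
  unfold codeLength
  omega

theorem getElem_encode_of_lt {n : ℕ} (A : τ.language.Structure (Fin n)) {i : ℕ} (hi : i < n) :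
    (τ.encode A)[i]? = some true := by
  rw [encode, List.getElem?_append_left (by simpa using hi)]
  simp [hi]

theorem getElem_encode_self {n : ℕ} (A : τ.language.Structure (Fin n)) :
    (τ.encode A)[n]? = some false := by
  rw [encode, List.getElem?_append_right (by simp)]
  simp

theorem exists_position (n : ℕ) {r : ℕ} (R : τ.language.Relations r) (ts : Fin r → Fin n) :
    ∃ p : Fin (τ.codeLength n), ∀ A : τ.language.Structure (Fin n), ∀ b : Bool,
      (τ.encode A)[p.val]? = some b → (A.RelMap R ts ↔ b = true) := by
  classical
  obtain ⟨i, rfl⟩ := R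
  obtain ⟨p, hp, H⟩ := exists_getElem_flatMap (fun i => n ^ τ.arity i) (List.finRange τ.card)
    (List.mem_finRange i) (finFunctionFinEquiv ts).isLt
  refine ⟨⟨n + 1 + p, Nat.add_lt_add_left hp _⟩, fun A b hb => ?_⟩
  rw [encode, List.getElem?_append_right (by simp; omega), List.length_replicate,
    show n + 1 + p - n = p + 1 by omega, List.getElem?_cons_succ, H _ (τ.length_table A)] at hb
  simp only [table, List.getElem?_ofFn, Fin.is_lt, dite_true, Option.some.injEq, Fin.eta,
    Equiv.symm_apply_apply] at hb
  rw [← hb, decide_eq_true_iff]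
  rfl

theorem exists_encode_eq {n : ℕ} (x : List Bool) (hx : x.length = τ.codeLength n)
    (h1 : ∀ i < n, x[i]? = some true) (h0 : x[n]? = some false) :
    ∃ A : τ.language.Structure (Fin n), τ.encode A = x := by
  classical
  obtain ⟨f, hf, H⟩ := exists_flatMap_eq (fun i => n ^ τ.arity i) (List.finRange τ.card)
    (List.nodup_finRange _) (x.drop (n + 1)) (by rw [List.length_drop, hx, codeLength]; omega)
  let A : τ.language.Structure (Fin n) :=
    { funMap := fun g => Empty.elim g
      RelMap := fun R ts => (f R.1)[(finFunctionFinEquiv fun a => ts (Fin.cast R.2 a)).val]? =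
        some true }
  have hA : ∀ i, τ.table A i = f i := by
    intro i
    refine List.ext_getElem (by rw [length_table, hf]) fun t ht ht' => ?_
    simp only [table, List.getElem_ofFn]
    have : (finFunctionFinEquiv fun a => finFunctionFinEquiv.symm
        (⟨t, by rw [← τ.length_table A i]; exact ht⟩ : Fin (n ^ τ.arity i)) a).val = t := by
      rw [Equiv.apply_symm_apply]
    rw [Bool.eq_iff_iff, decide_eq_true_iff]
    change (f i)[(finFunctionFinEquiv fun a => finFunctionFinEquiv.symm
        (⟨t, by rw [← τ.length_table A i]; exact ht⟩ : Fin (n ^ τ.arity i)) a).val]? =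
          some true ↔ _
    rw [this, List.getElem?_eq_getElem ht']
    simp
  refine ⟨A, ?_⟩
  rw [encode, funext hA, H]
  refine List.ext_getElem? fun i => ?_
  rcases lt_trichotomy i n with hi | rfl | hi
  · rw [List.getElem?_append_left (by simpa using hi), h1 i hi]
    simp [hi]
  · rw [List.getElem?_append_right (by simp), h0]
    simp
  · rw [List.getElem?_append_right (by simp; omega), List.length_replicate,
      show i - n = (i - n - 1) + 1 by omega, List.getElem?_cons_succ, List.getElem?_drop]
    congr 1
    omega

/-- The bit of the code of a structure which tells whether the tuple is in the relation. -/
noncomputable def position (n : ℕ) {r : ℕ} (R : τ.language.Relations r) (ts : Fin r → Fin n) :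
    Fin (τ.codeLength n) := (τ.exists_position n R ts).choose

/-- The structure that is read off from the bits of a word of the right length. -/
@[reducible]
noncomputable def decode {n : ℕ} (w : Fin (τ.codeLength n) → Bool) :
    τ.language.Structure (Fin n) where
  funMap := fun g => Empty.elim g
  RelMap := fun R ts => w (τ.position n R ts) = true

theorem decode_eq {n : ℕ} {w : Fin (τ.codeLength n) → Bool} {A : τ.language.Structure (Fin n)}
    (h : List.ofFn w = τ.encode A) : τ.decode w = A := by
  refine Language.Structure.ext ?_ ?_
  · funext r g
    exact Empty.elim g
  · funext r R ts
    refine propext ((τ.exists_position n R ts).choose_spec A _ ?_).symm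
    change (τ.encode A)[(τ.position n R ts).val]? = some (w (τ.position n R ts))
    rw [← h]
    simp

end Vocabulary

/-- At this length a word is a code as soon as it begins with `1 ⋯ 1 0`, because all tables are
allowed. -/
theorem mem_vertexDeletion_iff (τ : Vocabulary) (φ : τ.language.Sentence) {n : ℕ}
    (w : Fin (τ.codeLength n) → Bool) (k : ℕ) :
    (List.ofFn w, k) ∈ vertexDeletion τ φ ↔
      (∀ i : Fin n, w ⟨i, i.isLt.trans (τ.lt_codeLength n)⟩ = true) ∧
      (¬w ⟨n, τ.lt_codeLength n⟩ = true) ∧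
      letI := τ.decode w
      ∃ S : Finset (Fin n), S.card ≤ k ∧ (τ.delete (S : Set (Fin n))) ⊨ φ := by
  have hget : ∀ (i : ℕ) (hi : i < τ.codeLength n), (List.ofFn w)[i]? = some (w ⟨i, hi⟩) :=
    fun i hi => by simp [hi]
  constructor
  · rintro ⟨n', A, hA, hS⟩
    obtain rfl : n = n' := τ.codeLength_strictMono.injective (by
      rw [← τ.length_encode A, ← hA, List.length_ofFn])
    refine ⟨fun i => ?_, ?_, ?_⟩
    · have := τ.getElem_encode_of_lt A i.isLt
      rw [← hA, hget i (i.isLt.trans (τ.lt_codeLength n))] at this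
      exact Option.some.inj this
    · have := τ.getElem_encode_self A
      rw [← hA, hget n (τ.lt_codeLength n)] at this
      rw [Option.some.inj this]
      exact Bool.false_ne_true
    · rw [τ.decode_eq hA]
      exact hS
  · rintro ⟨h1, h0, hS⟩
    obtain ⟨A, hA⟩ := τ.exists_encode_eq (n := n) (List.ofFn w) (by simp)
      (fun i hi => by rw [hget i (hi.trans (τ.lt_codeLength n)), h1 ⟨i, hi⟩])
      (by rw [hget n (τ.lt_codeLength n), Bool.eq_false_of_not_eq_true h0])
    rw [τ.decode_eq hA.symm] at hS
    exact ⟨n, A, hA.symm, hS⟩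

/-! ### Vertex deletion for one quantifier alternation -/

theorem supportBound_primrec (d j : ℕ) : Primrec fun k => supportBound k d j := by
  induction j with
  | zero => exact Primrec.const 0
  | succ j ih =>
    exact Primrec.nat_mul.comp (Primrec.nat_mul.comp Primrec.id (Primrec.const d))
      (Primrec.nat_add.comp (Primrec.const 1) ih)

/-- The number of elements which the hash functions for the hitting set problem with sets of size
`d` and with parameter `k` have to separate. -/
def hashBound (d k : ℕ) : ℕ := (k + 1) * d + supportBound k d d

/-- The part of the fan-in that depends on the parameter. -/
def fanIn (d k : ℕ) : ℕ :=
  2 ^ (hashBound d k ^ 2 * hashBound d k ^ 2 + hashBound d k ^ 2 + 1) * 2 ^ 2 ^ (hashBound d k ^ 2)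

theorem fanIn_primrec (d : ℕ) : Primrec (fanIn d) := by
  have h1 : Primrec (hashBound d) := Primrec.nat_add.comp
    (Primrec.nat_mul.comp Primrec.succ (Primrec.const d)) (supportBound_primrec d d)
  have h2 : Primrec fun k => hashBound d k ^ 2 := primrec_pow_const h1 2
  have h3 : Primrec fun k => hashBound d k ^ 2 * hashBound d k ^ 2 + hashBound d k ^ 2 + 1 :=
    Primrec.succ.comp (Primrec.nat_add.comp (Primrec.nat_mul.comp h2 h2) h2)
  exact Primrec.nat_mul.comp (primrec_two_pow.comp h3)
    (primrec_two_pow.comp (primrec_two_pow.comp h2))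

theorem vertexDeletion_mem_paraAC0 (τ : Vocabulary) {φ : τ.language.Sentence} {f g : ℕ}
    (h : HasPattern φ (List.replicate f Quantifier.e ++ List.replicate g Quantifier.a)) :
    vertexDeletion τ φ ∈ ParaAC0 := by
  classical
  obtain ⟨N₁, N₂, h₁, h₂, ψ, hψ, hφ⟩ := h.exists_ex_all
  obtain ⟨D, hD⟩ := exists_hasFormula_of_isQF τ hψ
  have hpos : ∀ k, 2 ≤ fanIn N₂ k := fun k => by
    have h1 := Nat.one_le_two_pow (n := hashBound N₂ k ^ 2 * hashBound N₂ k ^ 2 + hashBound N₂ k ^ 2)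
    have h2 := Nat.one_le_two_pow (n := 2 ^ (hashBound N₂ k ^ 2))
    unfold fanIn
    rw [pow_succ]
    nlinarith
  -- Depth: `D + 2` for a conflict, four levels for each of `N₂ + 1` rounds, and four for two
  -- conjunctions, the choice of `zs` and a negation. The exponent `N₂ + 1` keeps `l + 1 ≤ M` also
  -- when `N₂ = 0`.
  refine mem_paraAC0_of_hasFormula (h := fanIn N₂) (c := N₂ + 1)
    (d := (D + 2) + 4 * (N₂ + 1) + 4) (fanIn_primrec N₂)
    (fun k => one_le_two.trans (hpos k)) fun l k => ?_
  by_cases hl : ∃ n, τ.codeLength n = l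
  swap
  · have hfalse : ∀ w : Fin l → Bool, (List.ofFn w, k) ∉ vertexDeletion τ φ := by
      rintro w ⟨n, A, hA, -⟩
      exact hl ⟨n, by rw [← τ.length_encode A, ← hA, List.length_ofFn]⟩
    simpa only [hfalse] using HasFormula.const False
  obtain ⟨n, rfl⟩ := hl
  have hn := τ.lt_codeLength n
  set l := τ.codeLength n
  set M := fanIn N₂ k * (l + 1) ^ (N₂ + 1) with hMdef
  have hfan : fanIn N₂ k ≤ M := Nat.le_mul_of_pos_right _ (by positivity)
  have hM : 2 ≤ M := (hpos k).trans hfan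
  have hpow : ∀ j ≤ N₂ + 1, (l + 1) ^ j ≤ M := fun j hj =>
    (Nat.pow_le_pow_right (Nat.succ_pos l) hj).trans
      (Nat.le_mul_of_pos_left _ (two_pos.trans_le (hpos k)))
  have hlM : l + 1 ≤ M := by simpa using hpow 1 (by omega)
  have htuple : ∀ j ≤ N₂, Nat.card (Fin j → Fin n) ≤ M := fun j hj => by
    rw [Nat.card_eq_fintype_card, Fintype.card_fun, Fintype.card_fin, Fintype.card_fin]
    exact (Nat.pow_le_pow_left (by omega) j).trans (hpow j (by omega))
  have hhash : Nat.card (BitChoice n (hashBound N₂ k)) ≤ M := by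
    refine (card_bitChoice_le n _).trans (Nat.mul_le_mul ?_ ?_)
    · exact Nat.le_mul_of_pos_right _ (by positivity)
    · refine (Nat.succ_le_succ hn.le).trans ?_
      exact Nat.le_self_pow (by omega) _
  have hcolour : 2 ^ 2 ^ (hashBound N₂ k ^ 2) ≤ M :=
    (Nat.le_mul_of_pos_left _ (by positivity)).trans hfan
  have hedges : (n + 1) ^ N₂ ≤ M :=
    (Nat.pow_le_pow_left (by omega) N₂).trans (hpow N₂ (by omega))
  have hQ : ∀ w : Fin l → Bool, (List.ofFn w, k) ∈ vertexDeletion τ φ ↔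
      (∀ i : Fin n, w ⟨i, i.isLt.trans hn⟩ = true) ∧ (¬w ⟨n, hn⟩ = true) ∧
      ∃ zs : Fin N₁ → Fin n, ¬Forced (hashBound N₂ k) k N₂
        (Conflict τ (τ.decode w) h₂ ψ zs) (N₂ + 1) ∅ := fun w => by
    rw [mem_vertexDeletion_iff, exists_deletion_iff τ (τ.decode w) hψ hφ k]
    refine and_congr_right' (and_congr_right' (exists_congr fun zs => ?_))
    exact exists_hitting_iff_not_forced (Nat.le_add_right _ _) (Nat.le_add_left _ _)
      fun e he => he.card_le
  simp only [hQ]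
  refine HasFormula.and hM ((HasFormula.all (d := 0) ?_ fun i => HasFormula.lit 0 _).mono (by omega))
    (HasFormula.and hM ((HasFormula.neg (d := 0) (HasFormula.lit 0 _)).mono (by omega))
      (HasFormula.ex (htuple N₁ h₂) fun zs => HasFormula.neg ?_))
  · rw [Nat.card_eq_fintype_card, Fintype.card_fin]
    omega
  · refine HasFormula.forced hM hhash hcolour hedges (D := D + 2) (fun e => ?_) (N₂ + 1) ∅
    -- For fixed `zs` and `e` the admissible `ys` are known without reading the input, so a conflict
    -- is a disjunction of negated instances of `ψ`.
    refine HasFormula.ex (d := D + 1) ?_ fun ys => HasFormula.neg ?_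
    · exact (Finite.card_subtype_le _).trans (htuple N₂ le_rfl)
    · exact hD n l M hM τ.decode (fun r R ts => ⟨τ.position n R ts, fun w => Iff.rfl⟩) ys.val

end VertexDeletion


theorem mainTheorem6 (f g : ℕ) :
    VertexDeletion.vdArb (List.replicate f VertexDeletion.Quantifier.e ++
      List.replicate g VertexDeletion.Quantifier.a) ⊆ VertexDeletion.ParaAC0 := by
  rintro _ ⟨τ, φ, hφ, rfl⟩
  exact VertexDeletion.vertexDeletion_mem_paraAC0 τ hφ
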